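/- A tri-pointed set is a set $X$ together with three pairwise distinct distinguished elements $T_X, L_X, R_X$. Let $\mathbf{Set_3}$ be the category of tri-pointed sets, whose morphisms are the functions that preserve the distinguished elements. Let $M=\{a,b,c\}$ and let $F:\mathbf{Set_3}\to\mathbf{Set_3}$ be the functor $F(X)=M\otimes X$, where $M\otimes X$ is the quotient of $M\times X$ by the equivalence relation generated by $(b,T_X)\sim(a,L_X)$, $(a,R_X)\sim(c,T_X)$, $(c,L_X)\sim(b,R_X)$; the class of $(m,x)$ is written $m\otimes x$, the distinguished elements of $M\otimes X$ are $T=a\otimes T_X$, $L=b\otimes L_X$, $R=c\otimes R_X$, and $F(f)(m\otimes x)=m\otimes f(x)$. Let $\sigma_a,\sigma_b,\sigma_c:\mathbb{R}^2\to\mathbb{R}^2$ be given by $\sigma_a(x,y)=(\tfrac x2,\tfrac y2)+(\tfrac14,\tfrac{\sqrt3}{4})$, $\sigma_b(x,y)=(\tfrac x2,\tfrac y2)$, $\sigma_c(x,y)=(\tfrac x2,\tfrac y2)+(\tfrac12,0)$. Let the Sierpinski gasket $\mathbb{S}\subset\mathbb{R}^2$ be the closure of the orbit under $\sigma_a,\sigma_b,\sigma_c$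 of their fixed points $(\tfrac12,\tfrac{\sqrt3}{2})$, $(0,0)$, $(1,0)$; equivalently, $\mathbb{S}$ is the unique nonempty compact set with $\mathbb{S}=\sigma_a(\mathbb{S})\cup\sigma_b(\mathbb{S})\cup\sigma_c(\mathbb{S})$. Regard $\mathbb{S}$ as a tri-pointed set with $T=(\tfrac12,\tfrac{\sqrt3}{2})$, $L=(0,0)$, $R=(1,0)$, and let $\tau:M\otimes\mathbb{S}\to\mathbb{S}$ be the morphism $\tau(m\otimes x)=\sigma_m(x)$. **Theorem.** The morphism $\tau$ is an isomorphism in $\mathbf{Set_3}$ and, with $\sigma=\tau^{-1}$, the pair $(\mathbb{S},\sigma)$ is the final $F$-coalgebra in $\mathbf{Set_3}$: for every $F$-coalgebra $(X,\, e:X\to M\otimes X)$ in $\mathbf{Set_3}$ there is exactly one morphism $f:X\to\mathbb{S}$ in $\mathbf{Set_3}$ with $\sigma\circ f=F(f)\circ e$. -/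

import Mathlib

open CategoryTheory

universe u

namespace Sierpinski

/-! ## The category of tri-pointed sets -/

/-- A tri-pointed set: a set with three (different) distinguished elements `T`, `L`, `R`. -/
structure TriSet : Type (u + 1) where
  carrier : Type u
  T : carrier
  L : carrier
  R : carrier
  T_ne_L : T ≠ L
  T_ne_R : T ≠ R
  L_ne_R : L ≠ R

/-- Morphisms of tri-pointed sets: functions that preserve the distinguished elements. -/
@[ext]
structure TriSet.Hom (X Y : TriSet.{u}) : Type u where
  toFun : X.carrier → Y.carrier
  map_T : toFun X.T = Y.T
  map_L : toFun X.L = Y.L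
  map_R : toFun X.R = Y.R

instance : Category TriSet.{u} where
  Hom X Y := TriSet.Hom X Y
  id X := ⟨fun x => x, rfl, rfl, rfl⟩
  comp f g := ⟨fun x => g.toFun (f.toFun x), by rw [f.map_T, g.map_T],
    by rw [f.map_L, g.map_L], by rw [f.map_R, g.map_R]⟩

/-! ## The functor `F = M ⊗ -` -/

/-- The three-element set of labels. -/
inductive M : Type
  | a
  | b
  | c

/-- The relations that generate the gluing of the three copies of `X`. -/
inductive Glue (X : TriSet.{u}) : M × X.carrier → M × X.carrier → Prop
  | bT_aL : Glue X (M.b, X.T) (M.a, X.L)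
  | aR_cT : Glue X (M.a, X.R) (M.c, X.T)
  | cL_bR : Glue X (M.c, X.L) (M.b, X.R)

/-- The quotient of `M × X` by the equivalence relation generated by `Glue X`. -/
def Tensor (X : TriSet.{u}) : Type u := Quot (Glue X)

/-- The class `m ⊗ x` of `(m, x)`. -/
def tmul (X : TriSet.{u}) (m : M) (x : X.carrier) : Tensor X := Quot.mk (Glue X) (m, x)

theorem tmul_aT_eq_iff (X : TriSet.{u}) (m : M) (x : X.carrier) :
    tmul X M.a X.T = tmul X m x ↔ M.a = m ∧ X.T = x := by
  constructor
  · intro h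
    have h2 := congrArg (Quot.lift (fun p : M × X.carrier => M.a = p.1 ∧ X.T = p.2) (by
      rintro _ _ (_ | _ | _) <;> simp [X.T_ne_L, X.T_ne_R])) h
    simpa [tmul] using h2
  · rintro ⟨rfl, rfl⟩
    rfl

theorem tmul_bL_eq_iff (X : TriSet.{u}) (m : M) (x : X.carrier) :
    tmul X M.b X.L = tmul X m x ↔ M.b = m ∧ X.L = x := by
  constructor
  · intro h
    have h2 := congrArg (Quot.lift (fun p : M × X.carrier => M.b = p.1 ∧ X.L = p.2) (by
      rintro _ _ (_ | _ | _) <;> simp [X.T_ne_L.symm, X.L_ne_R])) h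
    simpa [tmul] using h2
  · rintro ⟨rfl, rfl⟩
    rfl

/-- `F X = M ⊗ X` as a tri-pointed set. -/
def tensorObj (X : TriSet.{u}) : TriSet.{u} where
  carrier := Tensor X
  T := tmul X M.a X.T
  L := tmul X M.b X.L
  R := tmul X M.c X.R
  T_ne_L := by simp [tmul_aT_eq_iff]
  T_ne_R := by simp [tmul_aT_eq_iff]
  L_ne_R := by simp [tmul_bL_eq_iff]

/-- `F f = M ⊗ f`, sending `m ⊗ x` to `m ⊗ f x`. -/
def tensorMap {X Y : TriSet.{u}} (f : X ⟶ Y) : tensorObj X ⟶ tensorObj Y where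
  toFun := Quot.lift (fun p : M × X.carrier => tmul Y p.1 (f.toFun p.2)) (by
    rintro _ _ (_ | _ | _)
    · simp only [f.map_T, f.map_L]
      exact Quot.sound Glue.bT_aL
    · simp only [f.map_R, f.map_T]
      exact Quot.sound Glue.aR_cT
    · simp only [f.map_L, f.map_R]
      exact Quot.sound Glue.cL_bR)
  map_T := congrArg (tmul Y M.a) f.map_T
  map_L := congrArg (tmul Y M.b) f.map_L
  map_R := congrArg (tmul Y M.c) f.map_R

/-- The endofunctor `F = M ⊗ -` of the category of tri-pointed sets. -/
def F : TriSet.{u} ⥤ TriSet.{u} where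
  obj X := tensorObj X
  map f := tensorMap f
  map_id X := by
    apply TriSet.Hom.ext
    funext z
    induction z using Quot.ind
    rfl
  map_comp f g := by
    apply TriSet.Hom.ext
    funext z
    induction z using Quot.ind
    rfl

/-! ## The Sierpinski gasket -/

/-- The Euclidean plane. -/
abbrev Plane : Type := EuclideanSpace ℝ (Fin 2)

noncomputable section

/-- The translation parts of the three similarities. -/
def shift : M → Plane
  | M.a => !₂[1 / 4, √3 / 4]
  | M.b => !₂[0, 0]
  | M.c => !₂[1 / 2, 0]

/-- The similarities `σ_a`, `σ_b`, `σ_c` of the plane. -/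
def sim (m : M) (z : Plane) : Plane := (1 / 2 : ℝ) • z + shift m

/-- The fixed points of `σ_a`, `σ_b`, `σ_c`: the top, left and right corners. -/
def corner : M → Plane
  | M.a => !₂[1 / 2, √3 / 2]
  | M.b => !₂[0, 0]
  | M.c => !₂[1, 0]

/-- The orbit of the three corners under `σ_a`, `σ_b`, `σ_c`. -/
inductive Orbit : Plane → Prop
  | corner (m : M) : Orbit (corner m)
  | sim (m : M) (z : Plane) : Orbit z → Orbit (sim m z)

/-- The Sierpinski gasket: the closure of the orbit of the three corners. By `eq_gasket_iff` below,
it is the unique nonempty compact set `K` with `K = σ_a(K) ∪ σ_b(K) ∪ σ_c(K)`. -/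
def gasket : Set Plane := closure {z | Orbit z}

theorem sim_corner (m : M) : sim m (corner m) = corner m := by
  cases m <;> ext i <;> fin_cases i <;> simp [sim, shift, corner] <;> ring

theorem sim_glue_ba : sim M.b (corner M.a) = sim M.a (corner M.b) := by
  ext i; fin_cases i <;> simp [sim, shift, corner] <;> ring

theorem sim_glue_ac : sim M.a (corner M.c) = sim M.c (corner M.a) := by
  ext i; fin_cases i <;> simp [sim, shift, corner] <;> ring

theorem sim_glue_cb : sim M.c (corner M.b) = sim M.b (corner M.c) := by
  ext i; fin_cases i <;> simp [sim, shift, corner]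

theorem continuous_sim (m : M) : Continuous (sim m) := by
  unfold sim
  fun_prop

theorem dist_sim (m : M) (x y : Plane) : dist (sim m x) (sim m y) = 1 / 2 * dist x y := by
  simp [sim, dist_eq_norm, ← smul_sub, norm_smul]

theorem corner_mem (m : M) : corner m ∈ gasket := subset_closure (Orbit.corner m)

theorem sim_mem (m : M) {z : Plane} (hz : z ∈ gasket) : sim m z ∈ gasket :=
  map_mem_closure (continuous_sim m) hz fun w hw => Orbit.sim m w hw

theorem isCompact_gasket : IsCompact gasket := by
  obtain ⟨r, hr⟩ : ∃ r : ℝ, ∀ m, ‖corner m‖ ≤ r ∧ ‖shift m‖ ≤ r / 2 := by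
    refine ⟨‖corner M.a‖ + ‖corner M.b‖ + ‖corner M.c‖ +
      2 * (‖shift M.a‖ + ‖shift M.b‖ + ‖shift M.c‖), fun m => ?_⟩
    have h1 := norm_nonneg (corner M.a)
    have h2 := norm_nonneg (corner M.b)
    have h3 := norm_nonneg (corner M.c)
    have h4 := norm_nonneg (shift M.a)
    have h5 := norm_nonneg (shift M.b)
    have h6 := norm_nonneg (shift M.c)
    cases m <;> constructor <;> linarith
  refine Metric.isCompact_of_isClosed_isBounded isClosed_closure
    (Bornology.IsBounded.closure ((Metric.isBounded_closedBall (x := (0 : Plane)) (r := r)).subset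
      fun z hz => ?_))
  rw [mem_closedBall_zero_iff]
  induction hz with
  | corner m => exact (hr m).1
  | sim m z _ ih =>
    refine (norm_add_le _ _).trans ?_
    have h2 := (hr m).2
    rw [norm_smul]
    norm_num
    linarith

theorem gasket_eq_iUnion : gasket = ⋃ m, sim m '' gasket := by
  apply Set.Subset.antisymm
  · have hc : IsClosed (⋃ m, sim m '' gasket) := by
      have : Finite M := Finite.of_surjective
        (fun i : Fin 3 => match i with | 0 => M.a | 1 => M.b | 2 => M.c)
        (fun m => by cases m; exacts [⟨0, rfl⟩, ⟨1, rfl⟩, ⟨2, rfl⟩])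
      exact isClosed_iUnion_of_finite fun m =>
        (isCompact_gasket.image (continuous_sim m)).isClosed
    refine closure_minimal (fun z hz => ?_) hc
    rw [Set.mem_iUnion]
    cases hz with
    | corner m => exact ⟨m, corner m, corner_mem m, sim_corner m⟩
    | sim m z hz => exact ⟨m, z, subset_closure hz, rfl⟩
  · refine Set.iUnion_subset fun m => ?_
    rintro _ ⟨z, hz, rfl⟩
    exact sim_mem m hz

/-- The gasket is the unique nonempty compact set that is the union of its three images. -/
theorem eq_gasket_iff (K : Set Plane) :
    K = gasket ↔ K.Nonempty ∧ IsCompact K ∧ K = ⋃ m, sim m '' K := by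
  constructor
  · rintro rfl
    exact ⟨⟨_, corner_mem M.a⟩, isCompact_gasket, gasket_eq_iUnion⟩
  rintro ⟨hne, hK, hinv⟩
  have hstep : ∀ m z, z ∈ K → sim m z ∈ K := fun m z hz => by
    rw [hinv]
    exact Set.mem_iUnion.2 ⟨m, z, hz, rfl⟩
  have key : ∀ A : Set Plane, A.Nonempty → IsClosed A → (∀ m z, z ∈ A → sim m z ∈ A) →
      ∀ B : Set Plane, IsCompact B → (B ⊆ ⋃ m, sim m '' B) → B ⊆ A := by
    intro A hA hAc hAs B hB hBs x hx
    obtain ⟨w, hw, hmax⟩ := hB.exists_isMaxOn ⟨x, hx⟩ (Metric.continuous_infDist_pt A).continuousOn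
    obtain ⟨m, y, hy, rfl⟩ := Set.mem_iUnion.1 (hBs hw)
    have h1 : Metric.infDist y A ≤ Metric.infDist (sim m y) A := hmax hy
    have h2 : 2 * Metric.infDist (sim m y) A ≤ Metric.infDist y A := by
      rw [Metric.le_infDist hA]
      intro p hp
      have := Metric.infDist_le_dist_of_mem (x := sim m y) (hAs m p hp)
      rw [dist_sim] at this
      linarith
    have h3 : Metric.infDist x A ≤ Metric.infDist (sim m y) A := hmax hx
    have h4 := Metric.infDist_nonneg (x := x) (s := A)
    exact (hAc.mem_iff_infDist_zero hA).2 (by linarith)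
  exact Set.Subset.antisymm
    (key gasket ⟨_, corner_mem M.a⟩ isClosed_closure (fun m _ hz => sim_mem m hz) K hK hinv.le)
    (key K hne hK.isClosed hstep gasket isCompact_gasket gasket_eq_iUnion.le)

/-- The gasket as a tri-pointed set, with the three corners as distinguished elements. (`ULift` only
puts this set of points of the plane into the universe of the category.) -/
def gasketObj : TriSet.{u} where
  carrier := ULift.{u} gasket
  T := ⟨corner M.a, corner_mem M.a⟩
  L := ⟨corner M.b, corner_mem M.b⟩
  R := ⟨corner M.c, corner_mem M.c⟩
  T_ne_L := fun h => by
    have := congrArg (fun z : ULift gasket => (z.down : Plane) 0) h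
    norm_num [corner] at this
  T_ne_R := fun h => by
    have := congrArg (fun z : ULift gasket => (z.down : Plane) 0) h
    norm_num [corner] at this
  L_ne_R := fun h => by
    have := congrArg (fun z : ULift gasket => (z.down : Plane) 0) h
    norm_num [corner] at this

/-- `σ_m`, restricted to a map of the gasket into itself. -/
def gasketSim (m : M) (z : gasketObj.{u}.carrier) : gasketObj.{u}.carrier :=
  ⟨sim m z.down, sim_mem m z.down.2⟩

/-- The morphism `τ : M ⊗ 𝕊 ⟶ 𝕊`, `τ (m ⊗ x) = σ_m x`. -/
def tau : F.{u}.obj gasketObj.{u} ⟶ gasketObj.{u} where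
  toFun := Quot.lift (fun p : M × gasketObj.{u}.carrier => gasketSim p.1 p.2) (by
    rintro _ _ (_ | _ | _)
    · exact ULift.ext _ _ (Subtype.ext sim_glue_ba)
    · exact ULift.ext _ _ (Subtype.ext sim_glue_ac)
    · exact ULift.ext _ _ (Subtype.ext sim_glue_cb))
  map_T := ULift.ext _ _ (Subtype.ext (sim_corner M.a))
  map_L := ULift.ext _ _ (Subtype.ext (sim_corner M.b))
  map_R := ULift.ext _ _ (Subtype.ext (sim_corner M.c))

/-- The `F`-coalgebra `(𝕊, σ)` with `σ = τ⁻¹`, given that `τ` is invertible. -/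
def gasketCoalgebra (_ : IsIso tau.{u}) : Endofunctor.Coalgebra F.{u} where
  V := gasketObj
  str := inv tau

end

end Sierpinski

namespace Sierpinski

/-! Bijectivity of `tau`: it is onto because the gasket is the union of its three images. It is
injective because the gasket lies in the triangle of its corners (`barycentric_nonneg`), whose
half-size copies meet pairwise in a single point, and those points are exactly the ones that `Glue`
identifies.

Finality: write `e x = m x ⊗ y x`. A coalgebra morphism is then a solution of `f x = sim (m x) (f (y
x))`, a fixed point of an operator that halves uniform distances between maps into the compact
gasket. Iteration gives a solution (`exists_address`), and boundedness makes it unique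
(`address_unique`). Distinguished points are preserved automatically: their images under `e` are
singleton classes, so `f` sends each to the fixed point of one similarity. -/

/-! ### The triangle and the overlaps of its three copies -/

/-- Up to positive factors these are the barycentric coordinates for the top, right and left
corners. The scaling makes them linear in `z 1`, `√3 * z 0` and `√3`. -/
theorem Orbit.barycentric_nonneg {z : Plane} (hz : Orbit z) :
    0 ≤ z 1 ∧ 0 ≤ √3 * z 0 - z 1 ∧ 0 ≤ √3 - z 1 - √3 * z 0 := by
  have h3 : 0 < √3 := by positivity
  induction hz with
  | corner m => cases m <;> refine ⟨?_, ?_, ?_⟩ <;>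
      simp only [Sierpinski.corner, Matrix.cons_val_zero, Matrix.cons_val_one] <;> linarith
  | sim m z _ ih =>
    obtain ⟨h1, h2, h4⟩ := ih
    cases m <;> simp [Sierpinski.sim, shift] <;>
      refine ⟨?_, ?_, ?_⟩ <;> nlinarith

/-- The gasket lies in the triangle spanned by its corners. -/
theorem barycentric_nonneg {z : Plane} (hz : z ∈ gasket) :
    0 ≤ z 1 ∧ 0 ≤ √3 * z 0 - z 1 ∧ 0 ≤ √3 - z 1 - √3 * z 0 := by
  have hc : IsClosed {z : Plane | 0 ≤ z 1 ∧ 0 ≤ √3 * z 0 - z 1 ∧ 0 ≤ √3 - z 1 - √3 * z 0} := by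
    refine IsClosed.and ?_ (IsClosed.and ?_ ?_) <;>
      exact isClosed_le (by fun_prop) (by fun_prop)
  exact closure_minimal (fun z hz => Orbit.barycentric_nonneg hz) hc hz

/-- The factor `√3` lets linear arithmetic treat `√3 * z 0` as an atom, as in the triangle
inequalities above. -/
theorem plane_ext {z w : Plane} (h1 : z 1 = w 1) (h0 : √3 * z 0 = √3 * w 0) : z = w := by
  have h3 : √3 ≠ 0 := by positivity
  ext i
  fin_cases i
  · exact mul_left_cancel₀ h3 h0
  · exact h1

theorem sim_injective (m : M) : Function.Injective (sim m) := fun x y h => by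
  have := dist_sim m x y
  rw [h, dist_self] at this
  exact dist_eq_zero.1 (by linarith)

/-- The top coordinate is at most 1/2 on the `b`-copy and at least 1/2 on the `a`-copy, so equality
forces it to be 1 at `z`. The left coordinate likewise is 1 at `w`. The next two lemmas permute the
corners. -/
theorem eq_corners_of_sim_b_eq_sim_a {z w : Plane} (hz : z ∈ gasket) (hw : w ∈ gasket)
    (h : sim M.b z = sim M.a w) : z = corner M.a ∧ w = corner M.b := by
  obtain ⟨a1, a2, a3⟩ := barycentric_nonneg hz
  obtain ⟨b1, b2, b3⟩ := barycentric_nonneg hw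
  have h0 := congrArg (fun p : Plane => √3 * p 0) h
  have h1 := congrArg (fun p : Plane => p 1) h
  simp only [sim, shift, PiLp.add_apply, PiLp.smul_apply, smul_eq_mul, Matrix.cons_val_zero,
    Matrix.cons_val_one] at h0 h1
  constructor <;> apply plane_ext <;>
    simp only [corner, Matrix.cons_val_zero, Matrix.cons_val_one] <;> linarith

theorem eq_corners_of_sim_a_eq_sim_c {z w : Plane} (hz : z ∈ gasket) (hw : w ∈ gasket)
    (h : sim M.a z = sim M.c w) : z = corner M.c ∧ w = corner M.a := by
  obtain ⟨a1, a2, a3⟩ := barycentric_nonneg hz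
  obtain ⟨b1, b2, b3⟩ := barycentric_nonneg hw
  have h0 := congrArg (fun p : Plane => √3 * p 0) h
  have h1 := congrArg (fun p : Plane => p 1) h
  simp only [sim, shift, PiLp.add_apply, PiLp.smul_apply, smul_eq_mul, Matrix.cons_val_zero,
    Matrix.cons_val_one] at h0 h1
  constructor <;> apply plane_ext <;>
    simp only [corner, Matrix.cons_val_zero, Matrix.cons_val_one] <;> linarith

theorem eq_corners_of_sim_c_eq_sim_b {z w : Plane} (hz : z ∈ gasket) (hw : w ∈ gasket)
    (h : sim M.c z = sim M.b w) : z = corner M.b ∧ w = corner M.c := by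
  obtain ⟨a1, a2, a3⟩ := barycentric_nonneg hz
  obtain ⟨b1, b2, b3⟩ := barycentric_nonneg hw
  have h0 := congrArg (fun p : Plane => √3 * p 0) h
  have h1 := congrArg (fun p : Plane => p 1) h
  simp only [sim, shift, PiLp.add_apply, PiLp.smul_apply, smul_eq_mul, Matrix.cons_val_zero,
    Matrix.cons_val_one] at h0 h1
  constructor <;> apply plane_ext <;>
    simp only [corner, Matrix.cons_val_zero, Matrix.cons_val_one] <;> linarith

/-! ### Invertibility of `tau` -/

theorem tmul_bT_eq_aL (X : TriSet.{u}) : tmul X M.b X.T = tmul X M.a X.L := Quot.sound .bT_aL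

theorem tmul_aR_eq_cT (X : TriSet.{u}) : tmul X M.a X.R = tmul X M.c X.T := Quot.sound .aR_cT

theorem tmul_cL_eq_bR (X : TriSet.{u}) : tmul X M.c X.L = tmul X M.b X.R := Quot.sound .cL_bR

theorem tmul_cR_eq_iff (X : TriSet.{u}) (m : M) (x : X.carrier) :
    tmul X M.c X.R = tmul X m x ↔ M.c = m ∧ X.R = x := by
  constructor
  · intro h
    have h2 := congrArg (Quot.lift (fun p : M × X.carrier => M.c = p.1 ∧ X.R = p.2) (by
      rintro _ _ (_ | _ | _) <;> simp [X.T_ne_R.symm, X.L_ne_R.symm])) h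
    simpa [tmul] using h2
  · rintro ⟨rfl, rfl⟩
    rfl

theorem exists_tmul (X : TriSet.{u}) (z : Tensor X) : ∃ m x, z = tmul X m x := by
  induction z using Quot.ind with
  | mk p => exact ⟨p.1, p.2, rfl⟩

theorem gasketObj_ext {z w : gasketObj.{u}.carrier} (h : (z.down : Plane) = w.down) : z = w :=
  ULift.ext _ _ (Subtype.ext h)

theorem tau_injective : Function.Injective tau.{u}.toFun := by
  intro p q h
  obtain ⟨m, x, rfl⟩ := exists_tmul _ p
  obtain ⟨n, y, rfl⟩ := exists_tmul _ q
  have h' : sim m x.down = sim n y.down := congrArg (fun z : gasketObj.{u}.carrier => (z.down : Plane)) h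
  have ba : ∀ {z w : gasketObj.{u}.carrier}, sim M.b z.down = sim M.a w.down →
      tmul gasketObj M.b z = tmul gasketObj M.a w := fun {z w} h => by
    obtain ⟨h1, h2⟩ := eq_corners_of_sim_b_eq_sim_a z.down.2 w.down.2 h
    obtain rfl : z = gasketObj.T := gasketObj_ext h1
    obtain rfl : w = gasketObj.L := gasketObj_ext h2
    exact tmul_bT_eq_aL _
  have ac : ∀ {z w : gasketObj.{u}.carrier}, sim M.a z.down = sim M.c w.down →
      tmul gasketObj M.a z = tmul gasketObj M.c w := fun {z w} h => by
    obtain ⟨h1, h2⟩ := eq_corners_of_sim_a_eq_sim_c z.down.2 w.down.2 h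
    obtain rfl : z = gasketObj.R := gasketObj_ext h1
    obtain rfl : w = gasketObj.T := gasketObj_ext h2
    exact tmul_aR_eq_cT _
  have cb : ∀ {z w : gasketObj.{u}.carrier}, sim M.c z.down = sim M.b w.down →
      tmul gasketObj M.c z = tmul gasketObj M.b w := fun {z w} h => by
    obtain ⟨h1, h2⟩ := eq_corners_of_sim_c_eq_sim_b z.down.2 w.down.2 h
    obtain rfl : z = gasketObj.L := gasketObj_ext h1
    obtain rfl : w = gasketObj.R := gasketObj_ext h2
    exact tmul_cL_eq_bR _
  have same : ∀ m, sim m x.down = sim m y.down → tmul gasketObj m x = tmul gasketObj m y :=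
    fun m h => congrArg (tmul gasketObj m) (gasketObj_ext (sim_injective m h))
  cases m <;> cases n
  exacts [same _ h', (ba h'.symm).symm, ac h', ba h', same _ h', (cb h'.symm).symm,
    (ac h'.symm).symm, cb h', same _ h']

theorem tau_surjective : Function.Surjective tau.{u}.toFun := by
  rintro ⟨z, hz⟩
  obtain ⟨m, w, hw, rfl⟩ := Set.mem_iUnion.1 (gasket_eq_iUnion.subset hz)
  exact ⟨tmul gasketObj m ⟨w, hw⟩, rfl⟩

/-- A bijective morphism of tri-pointed sets is an isomorphism. -/
theorem TriSet.isIso_of_bijective {X Y : TriSet.{u}} (f : X ⟶ Y)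
    (hf : Function.Bijective f.toFun) : IsIso f := by
  obtain ⟨g, hl, hr⟩ := Function.bijective_iff_has_inverse.1 hf
  refine ⟨⟨g, ?_, ?_, ?_⟩, TriSet.Hom.ext (funext hl), TriSet.Hom.ext (funext hr)⟩
  · rw [← f.map_T, hl]
  · rw [← f.map_L, hl]
  · rw [← f.map_R, hl]

theorem isIso_tau : IsIso tau.{u} :=
  TriSet.isIso_of_bijective _ ⟨tau_injective, tau_surjective⟩

/-! ### Points of the gasket with a prescribed address -/

/-- The approximations to the solution of `f x = sim (m x) (f (y x))`. -/
noncomputable def addressApprox {α : Type u} (m : α → M) (y : α → α) : ℕ → α → Plane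
  | 0, _ => corner M.b
  | n + 1, x => sim (m x) (addressApprox m y n (y x))

/-- The only property of the starting value that matters is that it lies in the gasket. -/
theorem addressApprox_mem {α : Type u} (m : α → M) (y : α → α) (n : ℕ) (x : α) :
    addressApprox m y n x ∈ gasket := by
  induction n generalizing x with
  | zero => exact corner_mem _
  | succ n ih => exact sim_mem _ (ih _)

theorem dist_le_diam_gasket {z w : Plane} (hz : z ∈ gasket) (hw : w ∈ gasket) :
    dist z w ≤ Metric.diam gasket :=
  Metric.dist_le_diam_of_mem isCompact_gasket.isBounded hz hw

theorem dist_addressApprox_succ {α : Type u} (m : α → M) (y : α → α) (n : ℕ) (x : α) :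
    dist (addressApprox m y n x) (addressApprox m y (n + 1) x)
      ≤ Metric.diam gasket * (1 / 2) ^ n := by
  induction n generalizing x with
  | zero =>
    rw [pow_zero, mul_one]
    exact dist_le_diam_gasket (addressApprox_mem m y _ x) (addressApprox_mem m y _ x)
  | succ n ih =>
    have h := dist_sim (m x) (addressApprox m y n (y x)) (addressApprox m y (n + 1) (y x))
    change dist (sim _ _) (sim _ _) ≤ _
    rw [h, pow_succ]
    linarith [ih (y x)]

/-- `f x` is the point with address `m x, m (y x), m (y (y x)), …`, a limit of approximations with
geometrically decreasing steps. -/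
theorem exists_address {α : Type u} (m : α → M) (y : α → α) :
    ∃ f : α → Plane, (∀ x, f x ∈ gasket) ∧ ∀ x, f x = sim (m x) (f (y x)) := by
  have hlim : ∀ x, ∃ z, Filter.Tendsto (fun n => addressApprox m y n x) Filter.atTop (nhds z) :=
    fun x => cauchySeq_tendsto_of_complete
      (cauchySeq_of_le_geometric (1 / 2) _ (by norm_num)
        fun n => dist_addressApprox_succ m y n x)
  choose f hf using hlim
  refine ⟨f, fun x => ?_, fun x => ?_⟩
  · exact isClosed_closure.mem_of_tendsto (hf x)
      (Filter.Eventually.of_forall fun n => addressApprox_mem m y n x)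
  -- The recursion passes to the limit: the approximation of index `n + 1` at `x` is the image of
  -- the one of index `n` at `y x`.
  · exact tendsto_nhds_unique ((hf x).comp (Filter.tendsto_add_atTop_nat 1))
      (((continuous_sim (m x)).tendsto _).comp (hf (y x)))

theorem address_unique {α : Type u} {m : α → M} {y : α → α} {f g : α → Plane}
    (hf : ∀ x, f x ∈ gasket) (hg : ∀ x, g x ∈ gasket) (hfe : ∀ x, f x = sim (m x) (f (y x)))
    (hge : ∀ x, g x = sim (m x) (g (y x))) : f = g := by
  -- The bound is uniform in `x`, since each step moves from `x` to `y x`.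
  have key : ∀ n x, dist (f x) (g x) ≤ Metric.diam gasket * (1 / 2) ^ n := by
    intro n
    induction n with
    | zero => intro x; simpa using dist_le_diam_gasket (hf x) (hg x)
    | succ n ih =>
      intro x
      rw [hfe, hge, dist_sim, pow_succ]
      linarith [ih (y x)]
  funext x
  have hlim : Filter.Tendsto (fun n : ℕ => Metric.diam gasket * (1 / 2 : ℝ) ^ n) Filter.atTop
      (nhds (Metric.diam gasket * 0)) :=
    (tendsto_pow_atTop_nhds_zero_of_lt_one (by norm_num) (by norm_num)).const_mul _
  rw [mul_zero] at hlim
  exact dist_le_zero.1 (ge_of_tendsto' hlim fun n => key n x)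

/-! ### Finality -/

theorem eq_corner_of_sim_eq {m : M} {z : Plane} (h : z = sim m z) : z = corner m := by
  have := dist_sim m z (corner m)
  rw [← h, sim_corner] at this
  exact dist_eq_zero.1 (by linarith)

/-- Every coalgebra structure `e` admits exactly one `f` with `f = τ ∘ F f ∘ e`. -/
theorem existsUnique_comp_tau {X : TriSet.{u}} (e : X ⟶ F.obj X) :
    ∃! f : X ⟶ gasketObj.{u}, e ≫ F.map f ≫ tau = f := by
  -- A glued class has two representatives; either may be chosen, because `tau` and `F.map f` are
  -- defined on classes.
  choose m y hmy using fun x => exists_tmul X (e.toFun x)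
  have hcomp : ∀ (f : X ⟶ gasketObj.{u}) (x : X.carrier),
      (e ≫ F.map f ≫ tau).toFun x = gasketSim (m x) (f.toFun (y x)) := fun f x =>
    congrArg (fun z => tau.toFun ((F.map f).toFun z)) (hmy x)
  obtain ⟨f, hf, hfe⟩ := exists_address m y
  -- No gluing touches `a ⊗ T`, `b ⊗ L`, `c ⊗ R`, so here the representatives are forced and the
  -- equation for `f` becomes a fixed-point equation at each distinguished point.
  have hT := (tmul_aT_eq_iff X _ _).1 (e.map_T.symm.trans (hmy X.T))
  have hL := (tmul_bL_eq_iff X _ _).1 (e.map_L.symm.trans (hmy X.L))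
  have hR := (tmul_cR_eq_iff X _ _).1 (e.map_R.symm.trans (hmy X.R))
  have cT := hfe X.T
  have cL := hfe X.L
  have cR := hfe X.R
  rw [← hT.1, ← hT.2] at cT
  rw [← hL.1, ← hL.2] at cL
  rw [← hR.1, ← hR.2] at cR
  refine ⟨⟨fun x => ⟨f x, hf x⟩, gasketObj_ext (eq_corner_of_sim_eq cT),
    gasketObj_ext (eq_corner_of_sim_eq cL), gasketObj_ext (eq_corner_of_sim_eq cR)⟩, ?_, ?_⟩
  · refine TriSet.Hom.ext (funext fun x => ?_)
    rw [hcomp]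
    exact gasketObj_ext (hfe x).symm
  · intro g hg
    have hge : ∀ x, ((g.toFun x).down : Plane) = sim (m x) (g.toFun (y x)).down := fun x => by
      have := hcomp g x
      rw [hg] at this
      exact congrArg (fun z : gasketObj.{u}.carrier => (z.down : Plane)) this
    have := address_unique (fun x => (g.toFun x).down.2) hf hge hfe
    exact TriSet.Hom.ext (funext fun x => gasketObj_ext (congrFun this x))

theorem gasketCoalgebra_hom_iff (h : IsIso tau.{u}) (A : Endofunctor.Coalgebra F.{u})
    (f : A.V ⟶ gasketObj.{u}) :
    A.str ≫ F.map f = f ≫ (gasketCoalgebra h).str ↔ A.str ≫ F.map f ≫ tau = f := by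
  change _ = f ≫ inv tau ↔ _
  rw [IsIso.eq_comp_inv, Category.assoc]

end Sierpinski

theorem mainTheorem4 :
    ∃ h : CategoryTheory.IsIso Sierpinski.tau.{u},
      Nonempty (CategoryTheory.Limits.IsTerminal (Sierpinski.gasketCoalgebra.{u} h)) := by
  refine ⟨Sierpinski.isIso_tau, ⟨?_⟩⟩
  choose f hf hu using fun A : Endofunctor.Coalgebra Sierpinski.F.{u} =>
    Sierpinski.existsUnique_comp_tau A.str
  exact Limits.IsTerminal.ofUniqueHom
    (fun A => ⟨f A, (Sierpinski.gasketCoalgebra_hom_iff _ A _).2 (hf A)⟩)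
    fun A g => Endofunctor.Coalgebra.Hom.ext
      (hu A _ ((Sierpinski.gasketCoalgebra_hom_iff _ A _).1 g.h))
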